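/- Let $M$ be a (Hausdorff, finite-dimensional, boundaryless) real-analytic manifold with a real-analytic Riemannian metric, and let $G$ be a connected Lie group acting on $M$ by isometries, the action map $G\times M\to M$ being real-analytic. Let $N\ge 1$ and let $G$ act diagonally on $M^N$ by $g\cdot(X_1,\dots,X_N)=(g\cdot X_1,\dots,g\cdot X_N)$; give $M^N$ the product Riemannian metric. Let $\varphi:D\to\mathbb R$ be a jointly radial function, i.e. $D\subseteq M^N$ is an open dense subset that is invariant under the diagonal action, and $\varphi$ is real-analytic on $D$ and constant on the orbits of the diagonal action: $\varphi(g\cdot X)=\varphi(X)$ for all $g\in G$, $X\in D$. Then the gradient $F=\nabla\varphi=(F_1,\dots,F_N)$ with respect to the product metric is a jointly $G$-equivariant vector field on $D$, that is: 1. $F$ is a real-analytic vector field on $D$; 2. $T_{X_i}\Phi_g\,\big(F_i(X)\big)=F_i(g\cdot X)$ for all $g\in G$, $X\in D$ and $i=1,\dots,N$, where $\Phi_g:M\to M$ is $x\mapsto g\cdot x$ and $T\Phi_g$ is its differential; 3. the flow of $F$ commutes with the diagonal action: if $\gamma,\eta:(a,b)\to D$ with $a<0<b$ are solutions of $\dot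 X=F(X)$ and $\eta(0)=g\cdot\gamma(0)$ for some $g\in G$, then $\eta(t)=g\cdot\gamma(t)$ for all $t\in(a,b)$. -/

import Mathlib

open Bundle
open scoped Manifold ContDiff

noncomputable section

namespace JointDynamics

section Power

variable {E : Type*} [NormedAddCommGroup E] [NormedSpace ℝ E]
  {H : Type*} [TopologicalSpace H]

/-- The model with corners of the `N`-fold power `M ^ N = (Fin N → M)` of a manifold `M` that is
modelled on `I`. -/
abbrev powModel (I : ModelWithCorners ℝ E H) (N : ℕ) :
    ModelWithCorners ℝ (Fin N → E) (ModelPi fun _ : Fin N => H) :=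
  ModelWithCorners.pi fun _ : Fin N => I

variable {I : ModelWithCorners ℝ E H}
  {M : Type*} [TopologicalSpace M] [ChartedSpace H M] {N : ℕ}

/-- The power `M ^ N` of a `C^n` manifold is a `C^n` manifold. -/
instance isManifold_pow {n : WithTop ℕ∞} [IsManifold I n M] :
    IsManifold (powModel I N) n (Fin N → M) := by
  apply isManifold_of_contDiffOn
  rintro _ _ ⟨e, he, rfl⟩ ⟨e', he', rfl⟩
  rw [contDiffOn_pi]
  intro i
  have hc : ContDiffOn ℝ n (I ∘ (e i).symm ≫ₕ (e' i) ∘ I.symm)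
      (I.symm ⁻¹' ((e i).symm ≫ₕ (e' i)).source ∩ Set.range I) :=
    ((contDiffGroupoid n I).compatible (he i trivial) (he' i trivial)).1
  refine hc.comp (t := I.symm ⁻¹' ((e i).symm ≫ₕ (e' i)).source ∩ Set.range I)
    (f := fun y : Fin N → E => y i) (contDiff_apply ℝ E i).contDiffOn ?_
  rintro y ⟨⟨hy1, hy2⟩, ⟨z, hz⟩⟩
  exact ⟨⟨hy1 i trivial, hy2 i trivial⟩, ⟨z i, congrFun hz i⟩⟩

/-- The `i`-th component, in `T_{X i} M`, of a tangent vector to `M ^ N` at `X`. The preferred chart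
of `M ^ N` at `X` is the product of the preferred charts of `M` at the points `X i`, so this is the
canonical identification of `T_X (M ^ N)` with the product of the spaces `T_{X i} M`. -/
def component {X : Fin N → M} (v : TangentSpace (powModel I N) X) (i : Fin N) :
    TangentSpace I (X i) :=
  (show Fin N → E from v) i

end Power

section Gradient

variable {E : Type*} [NormedAddCommGroup E] [NormedSpace ℝ E]
  {H : Type*} [TopologicalSpace H] {I : ModelWithCorners ℝ E H}
  {M : Type*} [TopologicalSpace M] [ChartedSpace H M] {N : ℕ}
  [RiemannianBundle (fun x : M => TangentSpace I x)]

/-- The product Riemannian metric on `M ^ N`. -/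
def powMetric {X : Fin N → M} (u v : TangentSpace (powModel I N) X) : ℝ :=
  ∑ i, inner ℝ (component u i) (component v i)

/-- A linear form on `T_X (M ^ N)` is represented by exactly one vector. -/
theorem existsUnique_powMetric_eq [FiniteDimensional ℝ E] {X : Fin N → M}
    (L : TangentSpace (powModel I N) X →L[ℝ] ℝ) :
    ∃! u : TangentSpace (powModel I N) X, ∀ v, powMetric u v = L v := by
  classical
  have hfin : ∀ x : M, FiniteDimensional ℝ (TangentSpace I x) := fun _ =>
    inferInstanceAs (FiniteDimensional ℝ E)
  have hcomplete : ∀ x : M, CompleteSpace (TangentSpace I x) := fun x =>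
    FiniteDimensional.complete ℝ (TangentSpace I x)
  let ins : ∀ i : Fin N, TangentSpace I (X i) →ₗ[ℝ] TangentSpace (powModel I N) X := fun i =>
    (LinearMap.single ℝ (fun _ : Fin N => E) i : E →ₗ[ℝ] (Fin N → E))
  have hsum : ∀ v : TangentSpace (powModel I N) X, L v = ∑ i, L (ins i (component v i)) := by
    intro v
    rw [← map_sum]
    congr 1
    exact (Finset.univ_sum_single (show Fin N → E from v)).symm
  let ℓ : ∀ i : Fin N, TangentSpace I (X i) →L[ℝ] ℝ := fun i =>
    LinearMap.toContinuousLinearMap (L.toLinearMap ∘ₗ ins i)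
  let w : ∀ i : Fin N, TangentSpace I (X i) := fun i =>
    (InnerProductSpace.toDual ℝ (TangentSpace I (X i))).symm (ℓ i)
  have hw : ∀ i (z : TangentSpace I (X i)), inner ℝ (w i) z = L (ins i z) := fun i z =>
    InnerProductSpace.toDual_symm_apply
  refine ⟨(show Fin N → E from w), fun v => ?_, fun u hu => ?_⟩
  · rw [hsum v]
    exact Finset.sum_congr rfl fun i _ => hw i (component v i)
  · funext i
    change component u i = w i
    refine ext_inner_right ℝ fun z => ?_
    rw [hw i z, ← hu (ins i z), powMetric, Finset.sum_eq_single i]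
    · congr 1
      exact (Pi.single_eq_same (M := fun _ : Fin N => E) i z).symm
    · intro j _ hj
      have : component (ins i z) j = 0 := Pi.single_eq_of_ne (M := fun _ : Fin N => E) hj z
      rw [this, inner_zero_right]
    · simp

/-- The gradient of `φ : M ^ N → ℝ` for the product metric: the vector field `∇φ` with
`⟨∇φ(X), v⟩ = dφ_X(v)` for all tangent vectors `v` at `X`. -/
def gradient [FiniteDimensional ℝ E] (φ : (Fin N → M) → ℝ) (X : Fin N → M) :
    TangentSpace (powModel I N) X :=
  (existsUnique_powMetric_eq (mfderiv (powModel I N) 𝓘(ℝ, ℝ) φ X)).choose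

end Gradient

section Action

variable {E : Type*} [NormedAddCommGroup E] [NormedSpace ℝ E]
  {H : Type*} [TopologicalSpace H] (I : ModelWithCorners ℝ E H)
  (G : Type*) [Group G]

/-- Every element of `G` preserves the Riemannian metric of `M`. -/
def ActsByIsometries (M : Type*) [TopologicalSpace M] [ChartedSpace H M] [MulAction G M]
    [RiemannianBundle (fun x : M => TangentSpace I x)] : Prop :=
  ∀ (g : G) (x : M) (v w : TangentSpace I x),
    inner ℝ (mfderiv I I (fun y : M => g • y) x v) (mfderiv I I (fun y : M => g • y) x w)
      = inner ℝ v w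

variable {M : Type*} [TopologicalSpace M] [ChartedSpace H M] [MulAction G M] {N : ℕ}

/-- The function `φ`, with domain `D ⊆ M ^ N`, is jointly radial: `D` is open, dense and invariant
under the diagonal action `(g • X) i = g • X i`, and `φ` is analytic on `D` and constant on the
orbits of the diagonal action. The values of `φ` outside `D` are irrelevant. -/
structure IsJointlyRadial (D : Set (Fin N → M)) (φ : (Fin N → M) → ℝ) : Prop where
  isOpen : IsOpen D
  dense : Dense D
  smul_mem : ∀ (g : G), ∀ X ∈ D, g • X ∈ D
  analytic : ContMDiffOn (powModel I N) 𝓘(ℝ, ℝ) ω φ D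
  smul_eq : ∀ (g : G), ∀ X ∈ D, φ (g • X) = φ X

variable {I}

/-- The vector field `F` on `D ⊆ M ^ N` is jointly equivariant: it is analytic, its components
satisfy `T(g) F_i(X) = F_i(g • X)`, and its flow commutes with the diagonal action, i.e. the
solution of `F` through `g • X` is the image under `g` of the solution through `X`, on every
interval around `0` on which both exist in `D`. -/
structure IsJointlyEquivariant [IsManifold I ω M] (D : Set (Fin N → M))
    (F : (X : Fin N → M) → TangentSpace (powModel I N) X) : Prop where
  analytic : ContMDiffOn (powModel I N) (powModel I N).tangent ω
    (fun X => (⟨X, F X⟩ : TangentBundle (powModel I N) (Fin N → M))) D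
  map_component : ∀ (g : G), ∀ X ∈ D, ∀ i : Fin N,
    mfderiv I I (fun y : M => g • y) (X i) (component (F X) i) = component (F (g • X)) i
  flow_smul : ∀ (g : G) (a b : ℝ), a < 0 → 0 < b → ∀ γ η : ℝ → Fin N → M,
    (∀ t ∈ Set.Ioo a b, γ t ∈ D) → IsMIntegralCurveOn γ F (Set.Ioo a b) →
    (∀ t ∈ Set.Ioo a b, η t ∈ D) → IsMIntegralCurveOn η F (Set.Ioo a b) →
    η 0 = g • γ 0 → ∀ t ∈ Set.Ioo a b, g • γ t = η t

end Action

end JointDynamics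

end

/-! Since `φ ∘ g = φ` on the open set `D`, the chain rule gives `dφ_{gX} ∘ T = dφ_X`, where `T` is
the differential of `g` on `M ^ N`. As `T` preserves the product metric and is onto, `T (∇φ(X))`
satisfies the equation that characterises `∇φ(gX)`: this is `component_gradient_smul`. Hence `g`
carries integral curves of `∇φ` to integral curves, and their uniqueness
(`isMIntegralCurveOn_Ioo_eqOn_of_contMDiffAt`) gives the statement on flows. Analyticity
(`contMDiffAt_gradient`) is local: in a product chart the `i`-th component of `∇φ` is the inverse of
the metric of the `i`-th factor, applied to the `i`-th partial differential of `φ`, and inversion of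
operators is analytic. -/

noncomputable section

namespace JointDynamics

/-! ### Differential calculus on the power `M ^ N`. -/

section PowerCalculus

variable {E : Type*} [NormedAddCommGroup E] [NormedSpace ℝ E]
  {H : Type*} [TopologicalSpace H] {I : ModelWithCorners ℝ E H}
  {M : Type*} [TopologicalSpace M] [ChartedSpace H M] {N : ℕ}
  {E₁ : Type*} [NormedAddCommGroup E₁] [NormedSpace ℝ E₁]
  {H₁ : Type*} [TopologicalSpace H₁] {I₁ : ModelWithCorners ℝ E₁ H₁}
  {M₁ : Type*} [TopologicalSpace M₁] [ChartedSpace H₁ M₁]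

/-- Local uniqueness of integral curves on `M ^ N` is used in its boundaryless form. -/
instance boundaryless_powModel [I.Boundaryless] : (powModel I N).Boundaryless where
  range_eq_univ := by
    change Set.range (Pi.map fun _ : Fin N => (I : H → E)) = Set.univ
    rw [Set.range_piMap]
    simp [I.range_eq_univ]

theorem mem_chartAt_pow_source {X Y : Fin N → M} :
    Y ∈ (chartAt (ModelPi fun _ : Fin N => H) X).source ↔
      ∀ i, Y i ∈ (chartAt H (X i)).source :=
  ⟨fun h i => h i trivial, fun h i _ => h i⟩

/-- The `i`-th component of a tangent vector, as a continuous linear map. -/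
def componentL (X : Fin N → M) (i : Fin N) :
    TangentSpace (powModel I N) X →L[ℝ] TangentSpace I (X i) :=
  (ContinuousLinearMap.proj i : (Fin N → E) →L[ℝ] E)

theorem component_ext {X : Fin N → M} {u v : TangentSpace (powModel I N) X}
    (h : ∀ i, component u i = component v i) : u = v :=
  funext h

/-- The tangent vector with given components. -/
def ofComponents {X : Fin N → M} (w : ∀ i, TangentSpace I (X i)) :
    TangentSpace (powModel I N) X :=
  (show Fin N → E from w)

@[simp]
theorem component_ofComponents {X : Fin N → M} (w : ∀ i, TangentSpace I (X i)) (i : Fin N) :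
    component (ofComponents w) i = w i := rfl

/-- The preferred chart at `X` is the product of the charts at the `X i`, so evaluation reads there
as a coordinate projection on the chart target. -/
theorem hasMFDerivAt_eval (X : Fin N → M) (i : Fin N) :
    HasMFDerivAt (powModel I N) I (fun Y : Fin N → M => Y i) X (componentL X i) := by
  refine ⟨(continuous_apply i).continuousAt, ?_⟩
  have h : HasFDerivWithinAt (fun y : Fin N → E => y i)
      (ContinuousLinearMap.proj i : (Fin N → E) →L[ℝ] E)
      (Set.range (powModel I N)) (extChartAt (powModel I N) X X) :=
    (ContinuousLinearMap.proj i : (Fin N → E) →L[ℝ] E).hasFDerivWithinAt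
  refine h.congr_of_eventuallyEq ?_
    (congrFun ((extChartAt (powModel I N) X).right_inv (mem_extChartAt_target X)) i)
  filter_upwards [extChartAt_target_mem_nhdsWithin (I := powModel I N) X] with y hy
  exact congrFun ((extChartAt (powModel I N) X).right_inv hy) i

/-- A map into a power is differentiable as soon as its components are. -/
theorem hasMFDerivWithinAt_pow {f : M₁ → Fin N → M} {s : Set M₁} {x : M₁}
    {f' : TangentSpace I₁ x →L[ℝ] TangentSpace (powModel I N) (f x)}
    (h : ∀ i, HasMFDerivWithinAt I₁ I (fun y => f y i) s x ((componentL (f x) i).comp f')) :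
    HasMFDerivWithinAt I₁ (powModel I N) f s x f' := by
  refine ⟨continuousWithinAt_pi.2 fun i => (h i).1, ?_⟩
  exact hasFDerivWithinAt_pi'.2 fun i => (h i).2

theorem hasMFDerivAt_pow {f : M₁ → Fin N → M} {x : M₁}
    {f' : TangentSpace I₁ x →L[ℝ] TangentSpace (powModel I N) (f x)}
    (h : ∀ i, HasMFDerivAt I₁ I (fun y => f y i) x ((componentL (f x) i).comp f')) :
    HasMFDerivAt I₁ (powModel I N) f x f' := by
  rw [← hasMFDerivWithinAt_univ]
  exact hasMFDerivWithinAt_pow fun i => (h i).hasMFDerivWithinAt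

theorem contMDiff_eval {n : WithTop ℕ∞} (i : Fin N) :
    ContMDiff (powModel I N) I n (fun X : Fin N → M => X i) := by
  intro X
  rw [contMDiffAt_iff]
  refine ⟨(continuous_apply i).continuousAt, ?_⟩
  have h : ContDiffWithinAt ℝ n (fun y : Fin N → E => y i)
      (Set.range (powModel I N)) (extChartAt (powModel I N) X X) :=
    (contDiff_apply ℝ E i).contDiffWithinAt
  refine h.congr_of_eventuallyEq_of_mem ?_ ⟨_, rfl⟩
  filter_upwards [extChartAt_target_mem_nhdsWithin (I := powModel I N) X] with y hy
  exact congrFun ((extChartAt (powModel I N) X).right_inv hy) i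

/-- The continuous linear map between tangent spaces of powers acting on the components by given
maps. -/
def componentwise {X : Fin N → M} {Y : Fin N → M₁}
    (L : ∀ i, TangentSpace I (X i) →L[ℝ] TangentSpace I₁ (Y i)) :
    TangentSpace (powModel I N) X →L[ℝ] TangentSpace (powModel I₁ N) Y :=
  (ContinuousLinearMap.pi fun i =>
    (show E →L[ℝ] E₁ from L i).comp (ContinuousLinearMap.proj i) :
    (Fin N → E) →L[ℝ] (Fin N → E₁))

theorem componentL_comp_componentwise {X : Fin N → M} {Y : Fin N → M₁}
    (L : ∀ i, TangentSpace I (X i) →L[ℝ] TangentSpace I₁ (Y i)) (i : Fin N) :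
    (componentL Y i).comp (componentwise L) = (L i).comp (componentL X i) := rfl

/-- The differential of the map `f × ⋯ × f` between powers acts componentwise. -/
theorem hasMFDerivAt_pow_map {f : M → M₁} (hf : MDifferentiable I I₁ f) (X : Fin N → M) :
    HasMFDerivAt (powModel I N) (powModel I₁ N) (fun Y i => f (Y i)) X
      (componentwise fun i => mfderiv I I₁ f (X i)) := by
  refine hasMFDerivAt_pow fun i => ?_
  rw [componentL_comp_componentwise]
  exact (hf (X i)).hasMFDerivAt.comp X (hasMFDerivAt_eval X i)

end PowerCalculus

/-! ### The equation that characterises the gradient. -/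

section Gradient

variable {E : Type*} [NormedAddCommGroup E] [NormedSpace ℝ E] [FiniteDimensional ℝ E]
  {H : Type*} [TopologicalSpace H] {I : ModelWithCorners ℝ E H}
  {M : Type*} [TopologicalSpace M] [ChartedSpace H M] {N : ℕ}
  [RiemannianBundle (fun x : M => TangentSpace I x)]

theorem powMetric_gradient (φ : (Fin N → M) → ℝ) (X : Fin N → M)
    (v : TangentSpace (powModel I N) X) :
    powMetric (gradient φ X) v = mfderiv (powModel I N) 𝓘(ℝ, ℝ) φ X v :=
  (existsUnique_powMetric_eq (mfderiv (powModel I N) 𝓘(ℝ, ℝ) φ X)).choose_spec.1 v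

theorem eq_gradient {φ : (Fin N → M) → ℝ} {X : Fin N → M} {u : TangentSpace (powModel I N) X}
    (h : ∀ v, powMetric u v = mfderiv (powModel I N) 𝓘(ℝ, ℝ) φ X v) : u = gradient φ X :=
  (existsUnique_powMetric_eq (mfderiv (powModel I N) 𝓘(ℝ, ℝ) φ X)).unique h
    (powMetric_gradient φ X)

end Gradient

/-! ### Uniqueness of integral curves. -/

section Uniqueness

variable {E : Type*} [NormedAddCommGroup E] [NormedSpace ℝ E]
  {H : Type*} [TopologicalSpace H] {I : ModelWithCorners ℝ E H}
  {M : Type*} [TopologicalSpace M] [ChartedSpace H M] [IsManifold I 1 M] [T2Space M]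
  [BoundarylessManifold I M]

/-- Integral curves on an open interval are unique, for a vector field that is `C^1` along one of
them. -/
theorem isMIntegralCurveOn_Ioo_eqOn_of_contMDiffAt {v : (x : M) → TangentSpace I x}
    {γ γ' : ℝ → M} {a b t₀ : ℝ} (ht₀ : t₀ ∈ Set.Ioo a b)
    (hv : ∀ t ∈ Set.Ioo a b,
      ContMDiffAt I I.tangent 1 (fun x => (⟨x, v x⟩ : TangentBundle I M)) (γ t))
    (hγ : IsMIntegralCurveOn γ v (Set.Ioo a b)) (hγ' : IsMIntegralCurveOn γ' v (Set.Ioo a b))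
    (h : γ t₀ = γ' t₀) : Set.EqOn γ γ' (Set.Ioo a b) := by
  -- The agreement set is open by local uniqueness and closed because `M` is Hausdorff; the interval
  -- is connected.
  have hopen : IsOpen {t : Set.Ioo a b | γ t = γ' t} := by
    rw [isOpen_iff_mem_nhds]
    intro t ht
    have hmem : Set.Ioo a b ∈ nhds (t : ℝ) := Ioo_mem_nhds t.2.1 t.2.2
    exact continuousAt_subtype_val.eventually
      (isMIntegralCurveAt_eventuallyEq_of_contMDiffAt_boundaryless (hv t t.2)
        (hγ.isMIntegralCurveAt hmem) (hγ'.isMIntegralCurveAt hmem) ht)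
  have hclosed : IsClosed {t : Set.Ioo a b | γ t = γ' t} :=
    isClosed_eq (continuousOn_iff_continuous_domRestrict.1 hγ.continuousOn)
      (continuousOn_iff_continuous_domRestrict.1 hγ'.continuousOn)
  have : PreconnectedSpace (Set.Ioo a b) := Subtype.preconnectedSpace isPreconnected_Ioo
  have huniv := IsClopen.eq_univ ⟨hclosed, hopen⟩ ⟨⟨t₀, ht₀⟩, h⟩
  intro t ht
  exact Set.eq_univ_iff_forall.1 huniv ⟨t, ht⟩

end Uniqueness

/-! ### Equivariance of the gradient. -/

section Equivariance

variable {E : Type*} [NormedAddCommGroup E] [NormedSpace ℝ E] [FiniteDimensional ℝ E]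
  {H : Type*} [TopologicalSpace H] {I : ModelWithCorners ℝ E H}
  {M : Type*} [TopologicalSpace M] [ChartedSpace H M] {N : ℕ}
  [RiemannianBundle (fun x : M => TangentSpace I x)]
  {G : Type*} [Group G] [MulAction G M]

/-- An isometric linear map is injective, and both tangent spaces are `E`, of finite dimension. -/
theorem mfderiv_smul_surjective (hG : ActsByIsometries I G M) (g : G) (x : M) :
    Function.Surjective (mfderiv I I (fun y : M => g • y) x) := by
  let L : E →ₗ[ℝ] E := (mfderiv I I (fun y : M => g • y) x).toLinearMap
  have hinj : Function.Injective L := by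
    refine (injective_iff_map_eq_zero L).2 fun v hv => ?_
    have h := hG g x v v
    have hv' : mfderiv I I (fun y : M => g • y) x v = 0 := hv
    rw [hv', inner_zero_left] at h
    exact (inner_self_eq_zero (𝕜 := ℝ) (E := TangentSpace I x)).1 h.symm
  exact (LinearMap.injective_iff_surjective (f := L)).1 hinj

/-- The gradient of a jointly radial function is carried to itself by the diagonal action. -/
theorem component_gradient_smul (hd : ∀ g : G, MDifferentiable I I fun y : M => g • y)
    (hG : ActsByIsometries I G M) {D : Set (Fin N → M)} {φ : (Fin N → M) → ℝ}
    (hφ : IsJointlyRadial I G D φ) (g : G) {X : Fin N → M} (hX : X ∈ D) (i : Fin N) :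
    mfderiv I I (fun y : M => g • y) (X i) (component (gradient φ X) i) =
      component (gradient φ (g • X)) i := by
  have hL : HasMFDerivAt (powModel I N) (powModel I N) (fun Y : Fin N → M => g • Y) X
      (componentwise fun i => mfderiv I I (fun y : M => g • y) (X i)) :=
    hasMFDerivAt_pow_map (hd g) X
  set L : TangentSpace (powModel I N) X →L[ℝ] TangentSpace (powModel I N) (g • X) :=
    componentwise fun i => mfderiv I I (fun y : M => g • y) (X i) with hLdef
  have hcomp : ∀ v i, component (L v) i = mfderiv I I (fun y : M => g • y) (X i) (component v i) :=
    fun v i => rfl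
  have hφd : MDifferentiableAt (powModel I N) 𝓘(ℝ, ℝ) φ (g • X) :=
    ((hφ.analytic _ (hφ.smul_mem g X hX)).contMDiffAt
      (hφ.isOpen.mem_nhds (hφ.smul_mem g X hX))).mdifferentiableAt (by simp)
  have hinv : ∀ v, mfderiv (powModel I N) 𝓘(ℝ, ℝ) φ (g • X) (L v) =
      mfderiv (powModel I N) 𝓘(ℝ, ℝ) φ X v := by
    -- `φ ∘ g` and `φ` agree near `X` because `D` is open, so they have the same differential at
    -- `X`.
    have h₁ := hφd.hasMFDerivAt.comp X hL
    have h₂ : HasMFDerivAt (powModel I N) 𝓘(ℝ, ℝ) φ X _ := h₁.congr_of_eventuallyEq (by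
      filter_upwards [hφ.isOpen.mem_nhds hX] with Y hY
      exact (hφ.smul_eq g Y hY).symm)
    intro v
    rw [h₂.mfderiv]
    rfl
  have hsurj : ∀ w : TangentSpace (powModel I N) (g • X), ∃ v, L v = w := by
    intro w
    choose v hv using fun i => mfderiv_smul_surjective hG g (X i) (component w i)
    exact ⟨ofComponents v, component_ext fun i => by rw [hcomp, component_ofComponents]; exact hv i⟩
  have key : L (gradient φ X) = gradient φ (g • X) := by
    refine eq_gradient fun w => ?_
    -- Testing against vectors `L v` suffices, and there isometry and invariance of `dφ` apply.
    obtain ⟨v, rfl⟩ := hsurj w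
    rw [hinv, ← powMetric_gradient]
    exact Finset.sum_congr rfl fun i _ => hG g (X i) _ _
  rw [← key, hcomp]

end Equivariance

/-! ### Analyticity of the gradient. -/

section Analyticity

variable {E : Type*} [NormedAddCommGroup E] [NormedSpace ℝ E]
  {H : Type*} [TopologicalSpace H] {I : ModelWithCorners ℝ E H}
  {M : Type*} [TopologicalSpace M] [ChartedSpace H M] [IsManifold I ω M] {N : ℕ}

/-- The differential at `x` of the preferred chart at `x₀`. -/
def chartDeriv (x₀ x : M) : TangentSpace I x →L[ℝ] E :=
  (trivializationAt E (TangentSpace I) x₀).continuousLinearMapAt ℝ x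

theorem chartDeriv_eq_mfderiv {x₀ x : M} (hx : x ∈ (chartAt H x₀).source) :
    chartDeriv (I := I) x₀ x = mfderiv I 𝓘(ℝ, E) (extChartAt I x₀) x :=
  TangentBundle.continuousLinearMapAt_trivializationAt hx

theorem chartDeriv_apply {x₀ x : M} (hx : x ∈ (chartAt H x₀).source) (v : TangentSpace I x) :
    chartDeriv x₀ x v = (trivializationAt E (TangentSpace I) x₀ ⟨x, v⟩).2 := by
  rw [chartDeriv, Trivialization.continuousLinearMapAt_apply]
  exact congrFun (Trivialization.coe_linearMapAt_of_mem (R := ℝ)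
    (trivializationAt E (TangentSpace I) x₀) hx) v

theorem symm_chartDeriv {x₀ x : M} (hx : x ∈ (chartAt H x₀).source) (v : TangentSpace I x) :
    (trivializationAt E (TangentSpace I) x₀).symm x (chartDeriv x₀ x v) = v := by
  have h := Trivialization.symmL_continuousLinearMapAt (R := ℝ)
    (trivializationAt E (TangentSpace I) x₀) hx v
  rwa [Trivialization.symmL_apply _ hx] at h

theorem chartDeriv_surjective {x₀ x : M} (hx : x ∈ (chartAt H x₀).source) :
    Function.Surjective (chartDeriv (I := I) x₀ x) := fun e =>
  ⟨_, Trivialization.continuousLinearMapAt_symmL (R := ℝ)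
    (trivializationAt E (TangentSpace I) x₀) hx e⟩

/-- The chart of a power differentiates componentwise. -/
theorem chartDeriv_pow_apply {X₀ X : Fin N → M} (hX : ∀ i, X i ∈ (chartAt H (X₀ i)).source)
    (v : TangentSpace (powModel I N) X) (i : Fin N) :
    chartDeriv (I := powModel I N) X₀ X v i = chartDeriv (X₀ i) (X i) (component v i) := by
  have hX' := mem_chartAt_pow_source.2 hX
  have h₁ : HasMFDerivAt (powModel I N) 𝓘(ℝ, Fin N → E) (extChartAt (powModel I N) X₀) X _ :=
    (mdifferentiableAt_extChartAt hX').hasMFDerivAt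
  have h₂ : HasMFDerivAt I 𝓘(ℝ, E) (extChartAt I (X₀ i)) (X i) _ :=
    (mdifferentiableAt_extChartAt (hX i)).hasMFDerivAt
  have h₃ : HasMFDerivAt 𝓘(ℝ, Fin N → E) 𝓘(ℝ, E) (fun y : Fin N → E => y i)
      (extChartAt (powModel I N) X₀ X) (ContinuousLinearMap.proj i : (Fin N → E) →L[ℝ] E) :=
    (ContinuousLinearMap.proj i : (Fin N → E) →L[ℝ] E).hasMFDerivAt
  have h₄ : HasMFDerivAt (powModel I N) 𝓘(ℝ, E)
      (extChartAt I (X₀ i) ∘ fun Y : Fin N → M => Y i) X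
      ((mfderiv I 𝓘(ℝ, E) (extChartAt I (X₀ i)) (X i)).comp (componentL X i)) :=
    h₂.comp X (hasMFDerivAt_eval X i)
  -- Projecting after the product chart is the same map as applying the `i`-th chart after
  -- evaluation.
  have h := hasMFDerivAt_unique (h₃.comp X h₁) h₄
  rw [chartDeriv_eq_mfderiv hX', chartDeriv_eq_mfderiv (hX i)]
  exact DFunLike.congr_fun h v

/-- The Riemannian metric in the preferred chart at `x₀`. -/
theorem exists_contMDiffAt_metric [RiemannianBundle (fun x : M => TangentSpace I x)]
    [IsContMDiffRiemannianBundle I ω E (fun x : M => TangentSpace I x)] (x₀ : M) :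
    ∃ B : M → E →L[ℝ] E →L[ℝ] ℝ, ContMDiffAt I 𝓘(ℝ, E →L[ℝ] E →L[ℝ] ℝ) ω B x₀ ∧
      ∀ x ∈ (chartAt H x₀).source, ∀ u v : TangentSpace I x,
        B x (chartDeriv x₀ x u) (chartDeriv x₀ x v) = inner ℝ u v := by
  obtain ⟨g, hg, hg'⟩ := IsContMDiffRiemannianBundle.exists_contMDiff (IB := I) (n := ω) (F := E)
    (E := fun x : M => TangentSpace I x)
  refine ⟨_, (contMDiffAt_section x₀).1 hg.contMDiffAt, fun x hx u v => ?_⟩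
  rw [hom_trivializationAt_apply]
  rw [inCoordinates_apply_eq₂ hx hx (by simp)]
  rw [symm_chartDeriv hx, symm_chartDeriv hx, hg']
  simp

/-- The differential of a real function in the preferred chart at `x₀`. -/
theorem exists_contMDiffAt_differential {φ : M → ℝ} {x₀ : M}
    (hφ : ContMDiffAt I 𝓘(ℝ, ℝ) ω φ x₀) :
    ∃ A : M → E →L[ℝ] ℝ, ContMDiffAt I 𝓘(ℝ, E →L[ℝ] ℝ) ω A x₀ ∧
      ∀ x ∈ (chartAt H x₀).source, ∀ v : TangentSpace I x,
        A x (chartDeriv x₀ x v) = mfderiv I 𝓘(ℝ, ℝ) φ x v := by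
  -- No regularity is lost by differentiating, since `ω + 1 = ω`.
  refine ⟨_, hφ.mfderiv_const le_rfl, fun x hx v => ?_⟩
  rw [inTangentCoordinates_eq_mfderiv_comp (f := id) hx (mem_chart_source ℝ (φ x))]
  have h₁ : mfderiv 𝓘(ℝ, ℝ) 𝓘(ℝ, ℝ) (extChartAt 𝓘(ℝ, ℝ) (φ x₀)) (φ x) =
      ContinuousLinearMap.id ℝ ℝ := mfderiv_id
  have h₂ := Trivialization.symmL_continuousLinearMapAt (R := ℝ)
    (trivializationAt E (TangentSpace I) x₀) hx v
  rw [TangentBundle.symmL_trivializationAt hx] at h₂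
  rw [h₁]
  exact congrArg (mfderiv I 𝓘(ℝ, ℝ) φ x) h₂

theorem isInvertible_of_forall_apply_self_eq_zero [FiniteDimensional ℝ E] {B : E →L[ℝ] E →L[ℝ] ℝ}
    (h : ∀ e, B e e = 0 → e = 0) : B.IsInvertible := by
  have hinj : Function.Injective B.toLinearMap :=
    (injective_iff_map_eq_zero _).2 fun e he => h e (by
      have : B e = 0 := he
      simp [this])
  have hfin : Module.finrank ℝ E = Module.finrank ℝ (E →L[ℝ] ℝ) := by
    rw [← LinearEquiv.finrank_eq (LinearMap.toContinuousLinearMap (𝕜 := ℝ) (E := E) (F' := ℝ))]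
    exact Subspace.dual_finrank_eq.symm
  exact ⟨(LinearEquiv.ofInjectiveOfFinrankEq B.toLinearMap hinj hfin).toContinuousLinearEquiv,
    ContinuousLinearMap.ext fun _ => rfl⟩

/-- The gradient of an analytic function is analytic. -/
theorem contMDiffAt_gradient [FiniteDimensional ℝ E]
    [RiemannianBundle (fun x : M => TangentSpace I x)]
    [IsContMDiffRiemannianBundle I ω E (fun x : M => TangentSpace I x)]
    {φ : (Fin N → M) → ℝ} {X₀ : Fin N → M}
    (hφ : ContMDiffAt (powModel I N) 𝓘(ℝ, ℝ) ω φ X₀) :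
    ContMDiffAt (powModel I N) (powModel I N).tangent ω
      (fun X => (⟨X, gradient φ X⟩ : TangentBundle (powModel I N) (Fin N → M))) X₀ := by
  choose B hB hB' using fun i => exists_contMDiffAt_metric (I := I) (X₀ i)
  obtain ⟨A, hA, hA'⟩ := exists_contMDiffAt_differential hφ
  have hinv : ∀ i, ∀ x ∈ (chartAt H (X₀ i)).source, (B i x).IsInvertible := by
    intro i x hx
    refine isInvertible_of_forall_apply_self_eq_zero fun e he => ?_
    obtain ⟨u, rfl⟩ := chartDeriv_surjective (I := I) hx e
    rw [hB' i x hx] at he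
    rw [inner_self_eq_zero.1 he, map_zero]
  let single : ∀ i : Fin N, E →L[ℝ] (Fin N → E) := fun i =>
    ContinuousLinearMap.single ℝ (fun _ : Fin N => E) i
  -- The local formula for the gradient: `single i` restricts `dφ` to the `i`-th factor, and the
  -- inverse of `B i` raises the index.
  have hsmooth : ContMDiffAt (powModel I N) 𝓘(ℝ, Fin N → E) ω
      (fun X i => (B i (X i)).inverse ((A X).comp (single i))) X₀ := by
    refine contMDiffAt_pi_space.2 fun i => ?_
    refine ContMDiffAt.clm_apply ?_ (hA.clm_comp contMDiffAt_const)
    have h₁ : ContMDiffAt (powModel I N) 𝓘(ℝ, E →L[ℝ] E →L[ℝ] ℝ) ω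
        (fun X : Fin N → M => B i (X i)) X₀ :=
      (hB i).comp X₀ (contMDiff_eval i X₀)
    have : CompleteSpace E := FiniteDimensional.complete ℝ E
    exact (hinv i _ (mem_chart_source H _)).contDiffAt_map_inverse.contMDiffAt.comp X₀ h₁
  refine (contMDiffAt_section X₀).2 (hsmooth.congr_of_eventuallyEq ?_)
  filter_upwards [chart_source_mem_nhds (ModelPi fun _ : Fin N => H) X₀] with X hX
  have hX' := mem_chartAt_pow_source.1 hX
  funext i
  rw [← chartDeriv_apply hX, chartDeriv_pow_apply hX']
  refine ((hinv i _ (hX' i)).inverse_apply_eq.2 ?_).symm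
  ext e
  -- In the chart the test vector `v` lives in slot `i` alone, so only the `i`-th term of the
  -- product metric survives.
  obtain ⟨v, hv⟩ := chartDeriv_surjective (I := powModel I N) hX (single i e)
  have hvj : ∀ j, chartDeriv (X₀ j) (X j) (component v j) = single i e j := fun j => by
    rw [← chartDeriv_pow_apply hX', hv]
  have hsum := powMetric_gradient φ X v
  rw [← hA' X hX, hv, powMetric, Finset.sum_eq_single i] at hsum
  · rw [← hB' i _ (hX' i), hvj] at hsum
    simpa [single] using hsum.symm
  · intro j _ hj
    rw [← hB' j _ (hX' j), hvj]
    simp [single, hj]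
  · simp

end Analyticity

end JointDynamics

end

/-! ### The main theorem. -/

theorem proposition2p5
    {E : Type*} [NormedAddCommGroup E] [NormedSpace ℝ E] [FiniteDimensional ℝ E]
    {H : Type*} [TopologicalSpace H] {I : ModelWithCorners ℝ E H} [I.Boundaryless]
    {M : Type*} [TopologicalSpace M] [T2Space M] [ChartedSpace H M] [IsManifold I ω M]
    [RiemannianBundle (fun x : M => TangentSpace I x)]
    [IsContMDiffRiemannianBundle I ω E (fun x : M => TangentSpace I x)]
    {E' : Type*} [NormedAddCommGroup E'] [NormedSpace ℝ E'] [FiniteDimensional ℝ E']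
    {H' : Type*} [TopologicalSpace H'] {I' : ModelWithCorners ℝ E' H'} [I'.Boundaryless]
    {G : Type*} [Group G] [TopologicalSpace G] [ChartedSpace H' G] [LieGroup I' ω G]
    [ConnectedSpace G]
    [MulAction G M] [ContMDiffSMul I' I ω G M]
    (hG : JointDynamics.ActsByIsometries I G M)
    {N : ℕ} (D : Set (Fin N → M)) (φ : (Fin N → M) → ℝ)
    (hφ : JointDynamics.IsJointlyRadial I G D φ) :
    JointDynamics.IsJointlyEquivariant G D
      (JointDynamics.gradient (I := I) φ) := by
  have hd : ∀ g : G, MDifferentiable I I fun y : M => g • y := fun g =>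
    (ContMDiff.comp (ContMDiffSMul.contMDiff_smul (I := I') (I' := I) (n := ω) (G := G) (M := M))
      (contMDiff_const.prodMk contMDiff_id :
        ContMDiff I (I'.prod I) ω fun y : M => (g, y))).mdifferentiable (by simp)
  have hF : ∀ X ∈ D, ContMDiffAt (JointDynamics.powModel I N) (JointDynamics.powModel I N).tangent ω
      (fun X => (⟨X, JointDynamics.gradient (I := I) φ X⟩ :
        TangentBundle (JointDynamics.powModel I N) (Fin N → M))) X := fun X hX =>
    JointDynamics.contMDiffAt_gradient
      ((hφ.analytic X hX).contMDiffAt (hφ.isOpen.mem_nhds hX))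
  have hmap := fun (g : G) (X : Fin N → M) (hX : X ∈ D) (i : Fin N) =>
    JointDynamics.component_gradient_smul hd hG hφ g hX i
  refine ⟨fun X hX => (hF X hX).contMDiffWithinAt, hmap, ?_⟩
  intro g a b ha hb γ η hγD hγ hηD hη h₀
  have hgγ : IsMIntegralCurveOn (fun t => g • γ t) (JointDynamics.gradient (I := I) φ)
      (Set.Ioo a b) := by
    intro t ht
    have hg : HasMFDerivAt (JointDynamics.powModel I N) (JointDynamics.powModel I N)
        (fun X : Fin N → M => g • X) (γ t)
        (JointDynamics.componentwise fun i => mfderiv I I (fun y : M => g • y) (γ t i)) :=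
      JointDynamics.hasMFDerivAt_pow_map (hd g) (γ t)
    have h := hg.comp_hasMFDerivWithinAt t (hγ t ht)
    have hF' : JointDynamics.componentwise (fun i => mfderiv I I (fun y : M => g • y) (γ t i))
        (JointDynamics.gradient φ (γ t)) = JointDynamics.gradient (I := I) φ (g • γ t) :=
      JointDynamics.component_ext fun i => hmap g (γ t) (hγD t ht) i
    refine h.congr_mfderiv (ContinuousLinearMap.ext fun r : ℝ => ?_)
    change JointDynamics.componentwise (fun i => mfderiv I I (fun y : M => g • y) (γ t i))
        (r • JointDynamics.gradient φ (γ t)) = r • JointDynamics.gradient (I := I) φ (g • γ t)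
    rw [map_smul, hF']
  -- Regularity of the field is needed only along `g • γ`, which stays in `D` by invariance.
  exact JointDynamics.isMIntegralCurveOn_Ioo_eqOn_of_contMDiffAt (t₀ := 0) ⟨ha, hb⟩
    (fun t ht => (hF _ (hφ.smul_mem g _ (hγD t ht))).of_le (by simp)) hgγ hη h₀.symm
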